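/- Let $\Delta\ge 2$ be an integer and let $G_0,\dots,G_{\Delta-1}$ be finite simple connected graphs, each with at least two vertices and with maximum degree at most $\Delta$. Let $n_i$ denote the number of vertices of $G_i$. The strong product $G_0\boxtimes\cdots\boxtimes G_{\Delta-1}$ is the graph with vertex set $V(G_0)\times\cdots\times V(G_{\Delta-1})$ in which two distinct tuples $x,y$ are adjacent if and only if, for every $i$, $x_i=y_i$ or $x_iy_i\in E(G_i)$. The distinguishing index $D'(G)$ of a graph $G$ is the least $d$ such that $G$ has an edge labeling with $d$ labels that is preserved only by the identity automorphism of $G$ ($D'(G)=\infty$ if there is no such $d$). If $\prod_{i=0}^{\Delta-1} n_i\ge 7$, then $$D'(G_0\boxtimes\cdots\boxtimes G_{\Delta-1})\le 2.$$ -/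

import Mathlib

namespace SimpleGraph

/-- The strong product of a family of graphs: the vertices are the tuples, and two distinct tuples
are adjacent when in each coordinate their entries are equal or adjacent. -/
def strongProduct {ι : Type*} {V : ι → Type*} (G : ∀ i, SimpleGraph (V i)) :
    SimpleGraph (∀ i, V i) where
  Adj x y := x ≠ y ∧ ∀ i, x i = y i ∨ (G i).Adj (x i) (y i)
  symm := ⟨fun _ _ h => ⟨h.1.symm, fun i => (h.2 i).imp Eq.symm Adj.symm⟩⟩
  loopless := ⟨fun _ h => h.1 rfl⟩

/-- An edge labeling is distinguishing if the only automorphism that preserves all the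
edge labels is the identity. -/
def IsDistinguishingEdgeLabeling {V L : Type*} (G : SimpleGraph V) (c : G.edgeSet → L) : Prop :=
  ∀ σ : G ≃g G, (∀ e : G.edgeSet, c (σ.mapEdgeSet e) = c e) → ∀ v : V, σ v = v

/-- The distinguishing index: the least number `d` such that there is a distinguishing edge
labeling with `d` labels (and `⊤` if there is no such `d`, as for the graph `K₂`). -/
noncomputable def distinguishingIndex {V : Type*} (G : SimpleGraph V) : ℕ∞ :=
  ⨅ (d : ℕ) (_ : ∃ c : G.edgeSet → Fin d, G.IsDistinguishingEdgeLabeling c), (d : ℕ∞)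

end SimpleGraph

namespace SimpleGraph

/-! A two-label edge labeling is a spanning subgraph `S`; it suffices that only the identity
automorphism of the product preserves `S`.

For `Δ = 2` every factor has a Hamiltonian path, so the product contains a grid with diagonals. A
snake through the grid plus one chord is rigid by itself (`pathWithChord_rigid`).

For `Δ ≥ 3`, `S` grows from a seed. Maximal cliques of the factors give a clique `Q` with at least
`2 ^ Δ ≥ 8` vertices; there `q₁` hangs on `q₂`, `q₂` sees all of `Q`, and the rest carries a rigid
graph. Every vertex other than `q₁` keeps two `S`-neighbours, so `q₁`, then `q₂`, then `Q` pointwise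
are fixed. The box is then enlarged in one coordinate at a time (`Propagates.extend_box`). Once the
box is fixed, a new vertex can only move to one with the same neighbours in the box; distinct sets
of `S`-neighbours in the box separate these. Enough sets exist: for some `N ≥ 2 ^ (Δ - 1)`, a class
has at most `(Δ - 1) * N` members and at least `N - 1` usable neighbours
(`ncard_boxBoundary_class_le`). -/

/-! ### Rigidity of a path with a chord -/

/-- The path on `Fin n` with one additional edge joining `i` and `i + 2`. -/
def pathWithChord (n i : ℕ) : SimpleGraph (Fin n) where
  Adj s t := s.1 + 1 = t.1 ∨ t.1 + 1 = s.1 ∨ (s.1 = i ∧ t.1 = i + 2) ∨ (t.1 = i ∧ s.1 = i + 2)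
  symm := ⟨fun _ _ h => by omega⟩
  loopless := ⟨fun _ h => by omega⟩

theorem pathWithChord_adj {n i : ℕ} {s t : Fin n} : (pathWithChord n i).Adj s t ↔
    s.1 + 1 = t.1 ∨ t.1 + 1 = s.1 ∨ (s.1 = i ∧ t.1 = i + 2) ∨ (t.1 = i ∧ s.1 = i + 2) :=
  Iff.rfl

/-- Only the two ends have degree one, so `0` goes to an end. If `0` is fixed, follow the path. It
cannot go to `n - 1`: as `2 * i + 4 ≤ n`, the chord is nearer to `0`, and `i`, of degree three,
would land beyond the chord on a vertex of degree at most two. -/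
theorem pathWithChord_rigid {n i : ℕ} (hi : 1 ≤ i) (hn : 2 * i + 4 ≤ n)
    (f : pathWithChord n i ≃g pathWithChord n i) (t : Fin n) : f t = t := by
  have hadj : ∀ s t (hs : s < n) (ht : t < n),
      (s + 1 = t ∨ t + 1 = s ∨ (s = i ∧ t = i + 2) ∨ (t = i ∧ s = i + 2)) →
      ((f ⟨s, hs⟩).1 + 1 = (f ⟨t, ht⟩).1 ∨ (f ⟨t, ht⟩).1 + 1 = (f ⟨s, hs⟩).1 ∨
        ((f ⟨s, hs⟩).1 = i ∧ (f ⟨t, ht⟩).1 = i + 2) ∨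
        ((f ⟨t, ht⟩).1 = i ∧ (f ⟨s, hs⟩).1 = i + 2)) := by
    intro s t hs ht h
    exact f.map_rel_iff.2 (show (pathWithChord n i).Adj ⟨s, hs⟩ ⟨t, ht⟩ from h)
  have hinj : ∀ s t (hs : s < n) (ht : t < n), (f ⟨s, hs⟩).1 = (f ⟨t, ht⟩).1 → s = t := by
    intro s t hs ht h
    simpa using f.injective (Fin.ext h)
  have h0 : (f ⟨0, by omega⟩).1 = 0 ∨ (f ⟨0, by omega⟩).1 = n - 1 := by
    by_contra! hcon
    set s := (f ⟨0, by omega⟩).1 with hs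
    have hsn : s < n := (f ⟨0, by omega⟩).2
    have key : ∀ y (hy : y < n), (s + 1 = y ∨ y + 1 = s) → (f.symm ⟨y, hy⟩).1 = 1 := by
      intro y hy h
      have h1 : (pathWithChord n i).Adj (f ⟨0, by omega⟩) (f (f.symm ⟨y, hy⟩)) := by
        rw [f.apply_symm_apply, pathWithChord_adj]
        simp only [← hs]
        omega
      have h2 := pathWithChord_adj.1 (f.map_rel_iff.1 h1)
      simp only at h2
      omega
    have h1 := key (s + 1) (by omega) (by omega)
    have h2 := key (s - 1) (by omega) (by omega)
    have h3 := f.symm.injective (Fin.ext (h1.trans h2.symm))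
    simp only [Fin.mk.injEq] at h3
    omega
  rcases h0 with h0 | h0
  · have key : ∀ t, ∀ s (hs : s < n), s ≤ t → (f ⟨s, hs⟩).1 = s := by
      intro t
      induction t with
      | zero => intro s hs hst; obtain rfl : s = 0 := by omega
                exact h0
      | succ t ih =>
        intro s hs hst
        rcases Nat.lt_or_ge s (t + 1) with h | h
        · exact ih s hs (by omega)
        obtain rfl : s = t + 1 := by omega
        have hnot : ∀ r (hr : r < n), t < r → t < (f ⟨r, hr⟩).1 := by
          intro r hr htr
          by_contra! hle
          have h1 := ih (f ⟨r, hr⟩).1 (f ⟨r, hr⟩).2 hle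
          have := hinj _ _ _ _ h1
          omega
        have h1 := hadj t (t + 1) (by omega) hs (by omega)
        rw [ih t (by omega) le_rfl] at h1
        have h2 := hnot (t + 1) hs (by omega)
        by_cases hti : t = i
        · subst hti
          by_contra hne
          -- If the images of `i + 1` and `i + 2` were swapped, no unused vertex would be left for
          -- the image of `i + 3`.
          have h3 := hadj t (t + 2) (by omega) (by omega) (by omega)
          rw [ih t (by omega) le_rfl] at h3
          have h4 := hnot (t + 2) (by omega) (by omega)
          have h5 := hadj (t + 2) (t + 3) (by omega) (by omega) (by omega)
          have h6 := hnot (t + 3) (by omega) (by omega)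
          have h7 := hinj (t + 1) (t + 2) hs (by omega)
          have h8 := hinj (t + 1) (t + 3) hs (by omega)
          omega
        · omega
    exact Fin.ext (key t.1 t.1 t.2 le_rfl)
  · exfalso
    have key : ∀ t, ∀ s (hs : s < n), s ≤ t → t ≤ i → (f ⟨s, hs⟩).1 + s + 1 = n := by
      intro t
      induction t with
      | zero => intro s hs hst _; obtain rfl : s = 0 := by omega
                omega
      | succ t ih =>
        intro s hs hst hti
        rcases Nat.lt_or_ge s (t + 1) with h | h
        · exact ih s hs (by omega) (by omega)
        obtain rfl : s = t + 1 := by omega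
        have h1 := hadj t (t + 1) (by omega) hs (by omega)
        have h2 := ih t (by omega) le_rfl (by omega)
        have h3 := (f ⟨t + 1, hs⟩).2
        rcases Nat.eq_zero_or_pos t with h4 | h4
        · omega
        · have h5 := ih (t - 1) (by omega) (by omega) (by omega)
          have h6 := hinj (t - 1) (t + 1) (by omega) hs
          omega
    have h1 := key i i (by omega) le_rfl le_rfl
    have h2 := key i (i - 1) (by omega) (by omega) le_rfl
    have h3 := hadj i (i + 1) (by omega) (by omega) (by omega)
    have h4 := hadj i (i + 2) (by omega) (by omega) (by omega)
    have h5 := hinj (i - 1) (i + 1) (by omega) (by omega)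
    have h6 := hinj (i - 1) (i + 2) (by omega) (by omega)
    have h7 := hinj (i + 2) (i + 1) (by omega) (by omega)
    omega

/-! ### Labelings from subgraphs -/

/-- A labeling with two labels is obtained from a spanning subgraph. -/
theorem distinguishingIndex_le_two_of_subgraph {X : Type*} {H : SimpleGraph X} (S : SimpleGraph X)
    (hS : ∀ σ : H ≃g H, (∀ x y, S.Adj (σ x) (σ y) ↔ S.Adj x y) → ∀ x, σ x = x)
    (hle : S ≤ H) : H.distinguishingIndex ≤ 2 := by
  classical
  refine iInf₂_le (2 : ℕ) ⟨fun e => if e.1 ∈ S.edgeSet then 1 else 0, fun σ hσ => hS σ ?_⟩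
  intro x y
  by_cases hxy : H.Adj x y
  · have h := hσ ⟨s(x, y), hxy⟩
    have h' : (if s(σ x, σ y) ∈ S.edgeSet then (1 : Fin 2) else 0) =
      if s(x, y) ∈ S.edgeSet then 1 else 0 := h
    simp only [mem_edgeSet] at h'
    split_ifs at h' <;> simp_all
  · exact iff_of_false (fun h => hxy (σ.map_rel_iff.1 (hle h))) (fun h => hxy (hle h))

/-- A graph that has a Hamiltonian path with a suitable chord has distinguishing index at most
two. -/
theorem distinguishingIndex_le_two_of_pathWithChord {X : Type*} {H : SimpleGraph X} {n i : ℕ}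
    (hi : 1 ≤ i) (hn : 2 * i + 4 ≤ n) (e : Fin n ≃ X)
    (he : ∀ s t, (pathWithChord n i).Adj s t → H.Adj (e s) (e t)) :
    H.distinguishingIndex ≤ 2 := by
  refine distinguishingIndex_le_two_of_subgraph ((pathWithChord n i).comap e.symm) ?_ ?_
  · intro σ hσ x
    let f : pathWithChord n i ≃g pathWithChord n i :=
      { toEquiv := (e.trans σ.toEquiv).trans e.symm
        map_rel_iff' := by
          intro s t
          simpa using hσ (e s) (e t) }
    have h := pathWithChord_rigid hi hn f (e.symm x)
    simpa [f] using h
  · intro x y h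
    simpa using he _ _ h

/-- Every finite type with at least six elements carries a graph without isolated vertices and
without non-trivial automorphisms. -/
theorem exists_rigid (R : Type*) [Finite R] (hR : 6 ≤ Nat.card R) :
    ∃ T : SimpleGraph R, (∀ x, ∃ y, T.Adj x y) ∧ ∀ σ : T ≃g T, ∀ x, σ x = x := by
  let e := Finite.equivFin R
  refine ⟨(pathWithChord (Nat.card R) 1).comap e, fun x => ?_, fun σ x => ?_⟩
  · have hx := (e x).2
    by_cases h : (e x).1 + 1 < Nat.card R
    · exact ⟨e.symm ⟨(e x).1 + 1, h⟩, by simp [pathWithChord_adj]⟩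
    · refine ⟨e.symm ⟨(e x).1 - 1, by omega⟩, ?_⟩
      simp only [comap_adj, Equiv.apply_symm_apply, pathWithChord_adj]
      omega
  · let f : pathWithChord (Nat.card R) 1 ≃g pathWithChord (Nat.card R) 1 :=
      { toEquiv := (e.symm.trans σ.toEquiv).trans e
        map_rel_iff' := by
          intro s t
          simpa using σ.map_rel_iff (a := e.symm s) (b := e.symm t) }
    have h := pathWithChord_rigid le_rfl hR f (e x)
    simpa [f] using h

/-! ### Propagating fixedness to new vertices -/

/-- The subgraph `S` of `H` agrees with `S₀` on `Q`, has no edges between `F` and the complement of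
`Q`, has degree at least two at each vertex of `A` other than `q`, and each automorphism of `H`
that preserves the restriction of `S` to `A` and fixes `Q` pointwise also fixes `A` pointwise. -/
structure Propagates {X : Type*} (H S₀ : SimpleGraph X) (q : X) (F Q A : Set X)
    (S : SimpleGraph X) : Prop where
  le : S ≤ H
  agree : ∀ x ∈ Q, ∀ y ∈ Q, (S.Adj x y ↔ S₀.Adj x y)
  mem_of_adj : ∀ x ∈ F, ∀ y, S.Adj x y → y ∈ Q
  exists_two : ∀ x ∈ A, x ≠ q → ∃ y ∈ A, ∃ z ∈ A, y ≠ z ∧ S.Adj x y ∧ S.Adj x z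
  fixes : ∀ S' : SimpleGraph X, (∀ x ∈ A, ∀ y ∈ A, (S'.Adj x y ↔ S.Adj x y)) →
    ∀ σ : H ≃g H, (∀ x y, S'.Adj (σ x) (σ y) ↔ S'.Adj x y) → (∀ x ∈ Q, σ x = x) →
    ∀ x ∈ A, σ x = x

/-- A class consists of the vertices of `B` with a common neighbourhood `D` in `A`. By the bound it
injects into the power set of `D \ F`; different classes may reuse codes. -/
theorem exists_code {X : Type*} [Finite X] (H : SimpleGraph X) (A B F : Set X)
    (hcard : ∀ v ∈ B, {v' | v' ∈ B ∧ ∀ a ∈ A, H.Adj v' a ↔ H.Adj v a}.ncard ≤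
      2 ^ {a | a ∈ A ∧ a ∉ F ∧ H.Adj v a}.ncard) :
    ∃ code : X → Set X, (∀ v ∈ B, ∀ a ∈ code v, a ∈ A ∧ a ∉ F ∧ H.Adj v a) ∧
      ∀ v ∈ B, ∀ v' ∈ B, (∀ a ∈ A, H.Adj v' a ↔ H.Adj v a) → code v' = code v → v' = v := by
  let cls : Set X → Set X := fun D => {v | v ∈ B ∧ {a | a ∈ A ∧ H.Adj v a} = D}
  have hf : ∀ D : Set X, ∃ f : X → Set X, cls D ⊆ f ⁻¹' (D \ F).powerset ∧ (cls D).InjOn f := by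
    intro D
    refine (Set.toFinite _).exists_injOn_of_encard_le ?_
    rcases (cls D).eq_empty_or_nonempty with h | ⟨v, hvB, hvD⟩
    · simp [h]
    · rw [← (Set.toFinite (cls D)).cast_ncard_eq, ← (Set.toFinite ((D \ F).powerset)).cast_ncard_eq,
        Set.ncard_powerset]
      have h := hcard v hvB
      have h1 : {v' | v' ∈ B ∧ ∀ a ∈ A, H.Adj v' a ↔ H.Adj v a} = cls D := by
        ext v'
        simp only [cls, ← hvD, Set.ext_iff, Set.mem_ofPred_eq]
        grind
      have h2 : {a | a ∈ A ∧ a ∉ F ∧ H.Adj v a} = D \ F := by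
        ext a
        simp only [← hvD, Set.mem_sdiff, Set.mem_ofPred_eq]
        tauto
      rw [h1, h2] at h
      exact_mod_cast h
  choose f hf1 hf2 using hf
  refine ⟨fun v => f {a | a ∈ A ∧ H.Adj v a} v, fun v hv a ha => ?_, fun v hv v' hv' h hc => ?_⟩
  · have h := hf1 {a | a ∈ A ∧ H.Adj v a} (show v ∈ cls _ from ⟨hv, rfl⟩) ha
    exact ⟨h.1.1, h.2, h.1.2⟩
  · have hD : {a | a ∈ A ∧ H.Adj v' a} = {a | a ∈ A ∧ H.Adj v a} := by
      ext a
      exact and_congr_right fun ha => h a ha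
    simp only [hD] at hc
    exact hf2 _ ⟨hv', hD⟩ ⟨hv, rfl⟩ hc

/-- Keep `S` on `A`, take all edges of `H` inside `B`, and join each vertex of `B` to its code. An
automorphism fixing `A` preserves neighbourhoods in `A`, hence classes, and then codes. Codes avoid
`F`, so the vertices of `F` gain no neighbours. -/
theorem Propagates.extend {X : Type*} [Finite X] {H S₀ S : SimpleGraph X} {q : X}
    {F Q A B : Set X} (hS : Propagates H S₀ q F Q A S) (hFA : F ⊆ A) (hQA : Q ⊆ A)
    (hAB : Disjoint A B)
    (hclass : ∀ v ∈ B, ∀ v', v' ∉ A → (∀ a ∈ A, H.Adj v' a ↔ H.Adj v a) → v' ∈ B)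
    (hcard : ∀ v ∈ B, {v' | v' ∈ B ∧ ∀ a ∈ A, H.Adj v' a ↔ H.Adj v a}.ncard ≤
      2 ^ {a | a ∈ A ∧ a ∉ F ∧ H.Adj v a}.ncard)
    (htwo : ∀ v ∈ B, ∃ y ∈ B, ∃ z ∈ B, y ≠ z ∧ H.Adj v y ∧ H.Adj v z) :
    ∃ S', Propagates H S₀ q F Q (A ∪ B) S' := by
  obtain ⟨code, hcode, hinj⟩ := exists_code H A B F hcard
  have hdisj : ∀ x, x ∈ A → x ∉ B := fun x hx => Set.disjoint_left.1 hAB hx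
  let S' : SimpleGraph X :=
    { Adj := fun x y => (x ∈ A ∧ y ∈ A ∧ S.Adj x y) ∨ (x ∈ B ∧ y ∈ B ∧ H.Adj x y) ∨
        (y ∈ B ∧ x ∈ code y) ∨ (x ∈ B ∧ y ∈ code x)
      symm := ⟨fun x y h => by
        rcases h with h | h | h | h
        · exact Or.inl ⟨h.2.1, h.1, h.2.2.symm⟩
        · exact Or.inr (Or.inl ⟨h.2.1, h.1, h.2.2.symm⟩)
        · exact Or.inr (Or.inr (Or.inr h))
        · exact Or.inr (Or.inr (Or.inl h))⟩
      loopless := ⟨fun x h => by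
        rcases h with h | h | h | h
        · exact h.2.2.ne rfl
        · exact h.2.2.ne rfl
        · exact (hcode x h.1 x h.2).2.2.ne rfl
        · exact (hcode x h.1 x h.2).2.2.ne rfl⟩ }
  have hS'A : ∀ x ∈ A, ∀ y ∈ A, (S'.Adj x y ↔ S.Adj x y) := by
    intro x hx y hy
    have := hdisj x hx
    have := hdisj y hy
    simp only [S']
    tauto
  have hS'B : ∀ x ∈ B, ∀ y ∈ A, (S'.Adj x y ↔ y ∈ code x) := by
    intro x hx y hy
    have := hdisj x
    have := hdisj y hy
    simp only [S']
    tauto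
  refine ⟨S', ⟨?_, ?_, ?_, ?_, ?_⟩⟩
  · intro x y h
    rcases h with h | h | h | h
    · exact hS.le h.2.2
    · exact h.2.2
    · exact (hcode y h.1 x h.2).2.2.symm
    · exact (hcode x h.1 y h.2).2.2
  · intro x hx y hy
    rw [hS'A x (hQA hx) y (hQA hy), hS.agree x hx y hy]
  · intro x hx y h
    have hxB := hdisj x (hFA hx)
    rcases h with h | h | h | h
    · exact hS.mem_of_adj x hx y h.2.2
    · exact absurd h.1 hxB
    · exact absurd hx (hcode y h.1 x h.2).2.1
    · exact absurd h.1 hxB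
  · rintro x (hx | hx) hxq
    · obtain ⟨y, hy, z, hz, hyz, h1, h2⟩ := hS.exists_two x hx hxq
      exact ⟨y, Or.inl hy, z, Or.inl hz, hyz, (hS'A x hx y hy).2 h1, (hS'A x hx z hz).2 h2⟩
    · obtain ⟨y, hy, z, hz, hyz, h1, h2⟩ := htwo x hx
      exact ⟨y, Or.inr hy, z, Or.inr hz, hyz, Or.inr (Or.inl ⟨hx, hy, h1⟩),
        Or.inr (Or.inl ⟨hx, hz, h2⟩)⟩
  · intro T hT σ hσ hfix
    have hA : ∀ x ∈ A, σ x = x := hS.fixes T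
      (fun x hx y hy => (hT x (Or.inl hx) y (Or.inl hy)).trans (hS'A x hx y hy)) σ hσ hfix
    rintro v (hv | hv)
    · exact hA v hv
    have hvA : σ v ∉ A := fun h => hdisj v (σ.injective (hA _ h) ▸ h) hv
    have hnb : ∀ a ∈ A, H.Adj (σ v) a ↔ H.Adj v a := by
      intro a ha
      rw [← σ.map_rel_iff (a := v), hA a ha]
    have hσB := hclass v hv _ hvA hnb
    refine hinj v hv _ hσB hnb ?_
    ext a
    by_cases ha : a ∈ A
    · rw [← hS'B _ hσB a ha, ← hS'B v hv a ha, ← hT _ (Or.inr hσB) a (Or.inl ha),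
        ← hT v (Or.inr hv) a (Or.inl ha), ← hσ v a, hA a ha]
    · exact iff_of_false (fun h => ha (hcode _ hσB a h).1) (fun h => ha (hcode v hv a h).1)

/-! ### The rigid seed -/

/-- The base of the construction: `q₁` is adjacent to `q₂` only, `q₂` to all of `Q`, and the rest
of `Q` carries a rigid graph. -/
structure IsRigidBase {X : Type*} (S₀ : SimpleGraph X) (q₁ q₂ : X) (Q : Set X) : Prop where
  left_mem : q₁ ∈ Q
  right_mem : q₂ ∈ Q
  adj_left : ∀ y ∈ Q, S₀.Adj q₁ y ↔ y = q₂
  adj_right : ∀ y ∈ Q, S₀.Adj q₂ y ↔ y ≠ q₂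
  mem_of_adj : ∀ x y, S₀.Adj x y → x ∈ Q
  exists_adj : ∀ x ∈ Q, x ≠ q₁ → x ≠ q₂ → ∃ y, y ≠ q₂ ∧ S₀.Adj x y
  rigid : ∀ σ : X ≃ X, (∀ x, x ∈ Q → x ≠ q₁ → x ≠ q₂ → σ x ∈ Q ∧ σ x ≠ q₁ ∧ σ x ≠ q₂) →
    (∀ x ∈ Q, ∀ y ∈ Q, S₀.Adj (σ x) (σ y) ↔ S₀.Adj x y) →
    ∀ x, x ∈ Q → x ≠ q₁ → x ≠ q₂ → σ x = x

theorem exists_isRigidBase {X : Type*} [Finite X] {q₁ q₂ : X} {Q : Set X} (h₁ : q₁ ∈ Q)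
    (h₂ : q₂ ∈ Q) (hne : q₁ ≠ q₂) (hQ : 8 ≤ Q.ncard) :
    ∃ S₀ : SimpleGraph X, IsRigidBase S₀ q₁ q₂ Q := by
  classical
  let R : Set X := Q \ {q₁, q₂}
  have hR : 6 ≤ Nat.card R := by
    have h := Set.ncard_sdiff (s := {q₁, q₂}) (t := Q) (by simp [Set.insert_subset_iff, h₁, h₂])
      (Set.toFinite _)
    rw [Set.ncard_pair hne] at h
    rw [Nat.card_coe_set_eq, h]
    omega
  obtain ⟨T, hT, hrig⟩ := exists_rigid R hR
  have hRm : ∀ x, x ∈ R ↔ x ∈ Q ∧ x ≠ q₁ ∧ x ≠ q₂ := by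
    intro x
    simp [R]
  let S₀ : SimpleGraph X :=
    { Adj := fun x y => (x = q₂ ∧ y ∈ Q ∧ y ≠ q₂) ∨ (y = q₂ ∧ x ∈ Q ∧ x ≠ q₂) ∨
        ∃ (hx : x ∈ R) (hy : y ∈ R), T.Adj ⟨x, hx⟩ ⟨y, hy⟩
      symm := ⟨fun x y h => by
        rcases h with h | h | ⟨hx, hy, h⟩
        · exact Or.inr (Or.inl h)
        · exact Or.inl h
        · exact Or.inr (Or.inr ⟨hy, hx, h.symm⟩)⟩
      loopless := ⟨fun x h => by
        rcases h with h | h | ⟨hx, hy, h⟩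
        · exact h.2.2 h.1
        · exact h.2.2 h.1
        · exact h.ne rfl⟩ }
  have hS₀R : ∀ x (hx : x ∈ R) y (hy : y ∈ R), S₀.Adj x y ↔ T.Adj ⟨x, hx⟩ ⟨y, hy⟩ := by
    intro x hx y hy
    have := (hRm x).1 hx
    have := (hRm y).1 hy
    simp only [S₀]
    constructor
    · rintro (h | h | ⟨_, _, h⟩)
      · tauto
      · tauto
      · exact h
    · exact fun h => Or.inr (Or.inr ⟨hx, hy, h⟩)
  refine ⟨S₀, h₁, h₂, ?_, ?_, ?_, ?_, ?_⟩
  · intro y hy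
    have := hRm q₁
    have := hRm y
    simp only [S₀]
    constructor
    · rintro (h | h | ⟨h, _⟩) <;> tauto
    · rintro rfl
      tauto
  · intro y hy
    have := hRm q₂
    simp only [S₀]
    constructor
    · rintro (h | h | ⟨h, _⟩) <;> tauto
    · tauto
  · rintro x y (h | h | ⟨h, _⟩)
    · exact h.1 ▸ h₂
    · exact h.2.1
    · exact ((hRm x).1 h).1
  · intro x hx hx1 hx2
    obtain ⟨y, hy⟩ := hT ⟨x, (hRm x).2 ⟨hx, hx1, hx2⟩⟩
    exact ⟨y, ((hRm y).1 y.2).2.2, (hS₀R _ _ _ y.2).2 hy⟩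
  · intro σ hσR hσ x hx hx1 hx2
    have hmaps : ∀ x, x ∈ R → σ x ∈ R := by
      intro x hx
      obtain ⟨h1, h2, h3⟩ := (hRm x).1 hx
      exact (hRm _).2 (hσR x h1 h2 h3)
    let g : R → R := fun x => ⟨σ x, hmaps x x.2⟩
    have hg : Function.Bijective g := Finite.injective_iff_bijective.1 fun x y h =>
      Subtype.ext (σ.injective (congrArg Subtype.val h))
    let τ : T ≃g T :=
      { toEquiv := Equiv.ofBijective g hg
        map_rel_iff' := by
          intro a b
          rw [← hS₀R a a.2 b b.2, ← hσ a ((hRm a).1 a.2).1 b ((hRm b).1 b.2).1,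
            hS₀R _ (hmaps a a.2) _ (hmaps b b.2)]
          rfl }
    exact congrArg Subtype.val (hrig τ ⟨x, (hRm x).2 ⟨hx, hx1, hx2⟩⟩)

theorem Propagates.of_isRigidBase {X : Type*} {H S₀ : SimpleGraph X} {q₁ q₂ : X}
    {Q : Set X} (hS₀ : IsRigidBase S₀ q₁ q₂ Q) (hQ : H.IsClique Q) (hcard : 3 ≤ Q.ncard) :
    Propagates H S₀ q₁ {q₁, q₂} Q Q S₀ := by
  have hmem : ∀ x y, S₀.Adj x y → y ∈ Q := fun x y h => hS₀.mem_of_adj y x h.symm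
  refine ⟨fun x y h => hQ (hS₀.mem_of_adj x y h) (hmem x y h) h.ne, fun _ _ _ _ => Iff.rfl,
    fun x _ y h => hmem x y h, ?_, fun _ _ _ _ h => h⟩
  intro x hx hx1
  by_cases hx2 : x = q₂
  · subst hx2
    obtain ⟨z, hz, hz'⟩ := Set.exists_mem_notMem_of_ncard_lt_ncard (s := {q₁, x}) (t := Q)
      (lt_of_le_of_lt (Set.ncard_insert_le _ _) (by rw [Set.ncard_singleton]; omega))
      (Set.toFinite _)
    simp only [Set.mem_insert_iff, Set.mem_singleton_iff, not_or] at hz'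
    exact ⟨q₁, hS₀.left_mem, z, hz, Ne.symm hz'.1,
      (hS₀.adj_right _ hS₀.left_mem).2 (Ne.symm hx1), (hS₀.adj_right z hz).2 hz'.2⟩
  · obtain ⟨y, hy, h⟩ := hS₀.exists_adj x hx hx1 hx2
    exact ⟨y, hmem x y h, q₂, hS₀.right_mem, hy, h, ((hS₀.adj_right x hx).2 hx2).symm⟩

/-- In `S`, `q₁` is the only vertex without two neighbours, `q₂` is its only neighbour, and `Q` is
the closed neighbourhood of `q₂`. All three are thus invariant, and rigidity of the rest fixes `Q`
pointwise. -/
theorem Propagates.distinguishingIndex_le_two {X : Type*} {H S₀ S : SimpleGraph X} {q₁ q₂ : X}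
    {Q : Set X} (hS₀ : IsRigidBase S₀ q₁ q₂ Q)
    (hS : Propagates H S₀ q₁ {q₁, q₂} Q Set.univ S) : H.distinguishingIndex ≤ 2 := by
  refine distinguishingIndex_le_two_of_subgraph S (fun σ hσ x => ?_) hS.le
  refine hS.fixes S (fun _ _ _ _ => Iff.rfl) σ hσ ?_ x trivial
  have adj_left : ∀ y, S.Adj q₁ y ↔ y = q₂ := by
    intro y
    constructor
    · intro h
      have hy := hS.mem_of_adj q₁ (by simp) y h
      exact (hS₀.adj_left y hy).1 ((hS.agree _ hS₀.left_mem y hy).1 h)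
    · rintro rfl
      exact (hS.agree _ hS₀.left_mem _ hS₀.right_mem).2 ((hS₀.adj_left _ hS₀.right_mem).2 rfl)
  have adj_right : ∀ y, S.Adj q₂ y ↔ y ∈ Q ∧ y ≠ q₂ := by
    intro y
    constructor
    · intro h
      have hy := hS.mem_of_adj q₂ (by simp) y h
      exact ⟨hy, h.ne.symm⟩
    · rintro ⟨hy, h⟩
      exact (hS.agree _ hS₀.right_mem _ hy).2 ((hS₀.adj_right _ hy).2 h)
  have h1 : σ q₁ = q₁ := by
    by_contra hne
    obtain ⟨y, -, z, -, hyz, hy, hz⟩ := hS.exists_two (σ q₁) trivial hne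
    rw [← σ.apply_symm_apply y, hσ, adj_left] at hy
    rw [← σ.apply_symm_apply z, hσ, adj_left] at hz
    exact hyz (σ.symm.injective (hy.trans hz.symm))
  have h2 : σ q₂ = q₂ := by
    rw [← adj_left, ← congrArg (S.Adj · (σ q₂)) h1, hσ]
    exact (adj_left _).2 rfl
  have hQ : ∀ x ∈ Q, σ x ∈ Q := by
    intro x hx
    by_cases hx2 : x = q₂
    · rw [hx2, h2]
      exact hS₀.right_mem
    · have h := (adj_right x).2 ⟨hx, hx2⟩
      rw [← hσ, h2, adj_right] at h
      exact h.1
  have hR := hS₀.rigid σ.toEquiv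
    (fun x hx hx1 hx2 => ⟨hQ x hx, fun h => hx1 (σ.injective (h.trans h1.symm)),
      fun h => hx2 (σ.injective (h.trans h2.symm))⟩)
    (fun x hx y hy => by
      rw [← hS.agree x hx y hy, ← hσ]
      exact (hS.agree _ (hQ x hx) _ (hQ y hy)).symm)
  intro x hx
  by_cases hx1 : x = q₁
  · rw [hx1, h1]
  by_cases hx2 : x = q₂
  · rw [hx2, h2]
  exact hR x hx hx1 hx2

/-! ### Boxes, their boundaries and the counting of classes -/

/-- No vertex outside `W` has the same closed neighbourhood in `W` as a vertex of `W`. -/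
def IsTwinClosed {V : Type*} (G : SimpleGraph V) (W : Set V) : Prop :=
  ∀ x ∈ W, ∀ v, (∀ y ∈ W, (v = y ∨ G.Adj v y) ↔ (x = y ∨ G.Adj x y)) → v ∈ W

theorem isTwinClosed_univ {V : Type*} (G : SimpleGraph V) : G.IsTwinClosed Set.univ :=
  fun _ _ _ _ => trivial

/-- Take a maximal clique through the edge: a twin of a member sees the whole clique and could be
added to it. -/
theorem exists_isTwinClosed_isClique {V : Type*} [Finite V] {G : SimpleGraph V} {u w : V}
    (h : G.Adj u w) : ∃ C : Set V, u ∈ C ∧ w ∈ C ∧ G.IsClique C ∧ G.IsTwinClosed C := by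
  obtain ⟨C, hle, hC⟩ := Finite.exists_le_maximal (p := fun C : Set V => G.IsClique C)
    (a := {u, w}) (by simp [h])
  refine ⟨C, hle (by simp), hle (by simp), hC.prop, fun x hx v hv => ?_⟩
  have hins : G.IsClique (insert v C) := by
    refine isClique_insert.2 ⟨hC.prop, fun y hy hvy => ?_⟩
    refine ((hv y hy).2 ?_).resolve_left hvy
    by_cases hxy : x = y
    · exact Or.inl hxy
    · exact Or.inr (hC.prop hx hy hxy)
  exact hC.le_of_ge hins (Set.subset_insert v C) (Set.mem_insert v C)

section Step

variable {ι : Type*} {V : ι → Type*} {G : ∀ i, SimpleGraph (V i)}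

/-- The vertices that are added to the box `∏ W j` when `W i` is replaced by its closed
neighbourhood. -/
def boxBoundary (G : ∀ i, SimpleGraph (V i)) (W : ∀ i, Set (V i)) (i : ι) : Set (∀ i, V i) :=
  {v | v i ∉ W i ∧ (∃ p ∈ W i, (G i).Adj p (v i)) ∧ ∀ j, j ≠ i → v j ∈ W j}

theorem strongProduct_adj {x y : ∀ i, V i} :
    (strongProduct G).Adj x y ↔ x ≠ y ∧ ∀ i, x i = y i ∨ (G i).Adj (x i) (y i) :=
  Iff.rfl

/-- Putting `p` in place of `v i` gives a box neighbour of `v`, hence of `v'`; this controls all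
coordinates of `v'` up to adjacency. Letting coordinate `j` of that neighbour run through `W j`
shows that `v j` and `v' j` are twins relative to `W j`. -/
theorem mem_box_of_same_neighbors [DecidableEq ι] {W : ∀ i, Set (V i)} {i : ι}
    (hW : ∀ j, j ≠ i → (G j).IsTwinClosed (W j)) {v v' : ∀ i, V i} {p : V i}
    (hv : ∀ j, j ≠ i → v j ∈ W j) (hvi : v i ∉ W i) (hp : p ∈ W i) (hpv : (G i).Adj p (v i))
    (hv' : v' ∉ Set.univ.pi W)
    (hsame : ∀ a ∈ Set.univ.pi W, (strongProduct G).Adj v' a ↔ (strongProduct G).Adj v a) :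
    v' i ∉ W i ∧ (G i).Adj p (v' i) ∧
      ∀ j, j ≠ i → v' j ∈ W j ∧ (v j = v' j ∨ (G j).Adj (v j) (v' j)) := by
  have ha : Function.update v i p ∈ Set.univ.pi W := by
    intro j _
    by_cases hj : j = i
    · subst hj
      simpa using hp
    · simpa [hj] using hv j hj
  have hne : ∀ a ∈ Set.univ.pi W, v' ≠ a := fun a ha h => hv' (h ▸ ha)
  have hne' : ∀ a ∈ Set.univ.pi W, v ≠ a := fun a ha h => hvi (h ▸ ha i trivial)
  have hadj : (strongProduct G).Adj v (Function.update v i p) := by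
    refine ⟨hne' _ ha, fun j => ?_⟩
    by_cases hj : j = i
    · subst hj
      simpa using Or.inr hpv.symm
    · simp [hj]
  have hadj' := ((hsame _ ha).2 hadj).2
  have h1 : ∀ j, j ≠ i → (v' j = v j ∨ (G j).Adj (v' j) (v j)) := by
    intro j hj
    simpa [hj] using hadj' j
  have h2 : v' i = p ∨ (G i).Adj (v' i) p := by simpa using hadj' i
  have h3 : ∀ j, j ≠ i → v' j ∈ W j := by
    intro j hj
    refine hW j hj (v j) (hv j hj) (v' j) fun y hy => ?_
    have hb : Function.update (Function.update v i p) j y ∈ Set.univ.pi W := by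
      intro l _
      by_cases hl : l = j
      · subst hl
        simpa using hy
      · simpa [hl] using ha l trivial
    have h := hsame _ hb
    rw [strongProduct_adj, strongProduct_adj] at h
    constructor
    · intro hvy
      have h4 := (h.1 ⟨hne _ hb, fun l => ?_⟩).2 j
      · simpa using h4
      · by_cases hl : l = j
        · subst hl
          simpa using hvy
        · simpa [hl] using hadj' l
    · intro hvy
      have h4 := (h.2 ⟨hne' _ hb, fun l => ?_⟩).2 j
      · simpa using h4
      · by_cases hl : l = j
        · subst hl
          simpa using hvy
        · simpa [hl] using hadj.2 l
  have h4 : v' i ∉ W i := by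
    intro h
    refine hv' fun j _ => ?_
    by_cases hj : j = i
    · subst hj
      exact h
    · exact h3 j hj
  refine ⟨h4, ?_, fun j hj => ⟨h3 j hj, (h1 j hj).imp Eq.symm Adj.symm⟩⟩
  exact (h2.resolve_left fun h => h4 (h ▸ hp)).symm

/-- The start `N = 2 ^ m` follows from `m ≤ 2 ^ (m - 1)` and `2 * m ≤ 2 ^ m`; afterwards each step
doubles the right side and adds only `m` to the left. -/
theorem mul_le_two_pow_pred {m N : ℕ} (hm : 2 ≤ m) (hN : 2 ^ m ≤ N) : m * N ≤ 2 ^ (N - 1) := by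
  have key : 2 * m ≤ 2 ^ m ∧ m ≤ 2 ^ (m - 1) := by
    clear hN
    induction m, hm using Nat.le_induction with
    | base => norm_num
    | succ m hm ih =>
      rw [pow_succ]
      have : m + 1 - 1 = m := rfl
      rw [this]
      omega
  induction N, hN using Nat.le_induction with
  | base =>
    calc m * 2 ^ m ≤ 2 ^ (m - 1) * 2 ^ m := Nat.mul_le_mul_right _ key.2
      _ = 2 ^ (m - 1 + m) := (pow_add _ _ _).symm
      _ ≤ 2 ^ (2 ^ m - 1) := Nat.pow_le_pow_right (by norm_num) (by omega)
  | succ N hN ih =>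
    have h2 : 1 ≤ N := le_trans Nat.one_le_two_pow hN
    have h1 : 2 ^ (N + 1 - 1) = 2 * 2 ^ (N - 1) := by
      rw [← pow_succ']
      congr 1
      omega
    rw [h1]
    nlinarith

theorem ncard_pi_update [Fintype ι] [DecidableEq ι] [∀ i, Finite (V i)] (Y : ∀ i, Set (V i))
    (i : ι) (T : Set (V i)) :
    (Set.univ.pi (Function.update Y i T)).ncard =
      T.ncard * ∏ j ∈ Finset.univ \ {i}, (Y j).ncard := by
  classical
  have := fun i => Fintype.ofFinite (V i)
  have h : Set.univ.pi (Function.update Y i T) =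
      ↑(Fintype.piFinset fun j => (Function.update Y i T j).toFinset) := by
    ext x
    simp
  rw [h, Set.ncard_coe_finset, Fintype.card_piFinset]
  simp only [← Set.ncard_eq_toFinset_card']
  rw [Finset.prod_eq_mul_prod_sdiff_singleton_of_mem (Finset.mem_univ i)]
  simp only [Function.update_self]
  congr 1
  refine Finset.prod_congr rfl fun j hj => ?_
  rw [Function.update_of_ne (by simpa using hj)]

/-- Both sides are compared with `N`, the number of choices in the coordinates other than `i` within
the box and the closed neighbourhood of `v`. A class member also chooses a neighbour of `p` outside
`W i`; a box neighbour of `v` can be built with `p` itself. -/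
theorem ncard_boxBoundary_class_le [Fintype ι] [DecidableEq ι] [∀ i, Finite (V i)]
    (hι : 3 ≤ Fintype.card ι)
    (hdeg : ∀ i v, ((G i).neighborSet v).ncard ≤ Fintype.card ι) {W : ∀ i, Set (V i)} {i : ι}
    (hW : ∀ j, j ≠ i → (G j).IsTwinClosed (W j)) (hadj : ∀ j, ∀ x ∈ W j, ∃ y ∈ W j, (G j).Adj x y)
    {q₁ q₂ : ∀ i, V i} (hq : q₁ i ≠ q₂ i) {v : ∀ i, V i} (hv : v ∈ boxBoundary G W i) :
    {v' | v' ∈ boxBoundary G W i ∧ ∀ a ∈ Set.univ.pi W,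
      (strongProduct G).Adj v' a ↔ (strongProduct G).Adj v a}.ncard ≤
    2 ^ {a | a ∈ Set.univ.pi W ∧ a ∉ ({q₁, q₂} : Set (∀ i, V i)) ∧
      (strongProduct G).Adj v a}.ncard := by
  obtain ⟨hvi, ⟨p, hp, hpv⟩, hvj⟩ := hv
  let Y : ∀ j, Set (V j) := fun j => {y | y ∈ W j ∧ (v j = y ∨ (G j).Adj (v j) y)}
  let N := ∏ j ∈ Finset.univ \ {i}, (Y j).ncard
  have hN : 2 ^ (Fintype.card ι - 1) ≤ N := by
    have hc : (Finset.univ \ {i} : Finset ι).card = Fintype.card ι - 1 := by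
      rw [Finset.card_sdiff]
      simp
    rw [← hc]
    refine Finset.pow_card_le_prod _ _ _ fun j hj => ?_
    have hj : j ≠ i := by simpa using hj
    obtain ⟨y, hy, hvy⟩ := hadj j (v j) (hvj j hj)
    rw [← Set.ncard_pair hvy.ne]
    refine Set.ncard_le_ncard ?_ (Set.toFinite _)
    rintro z (rfl | rfl)
    · exact ⟨hvj j hj, Or.inl rfl⟩
    · exact ⟨hy, Or.inr hvy⟩
  -- One of the neighbours of `p` already lies in `W i`.
  have hT : ((G i).neighborSet p \ W i).ncard ≤ Fintype.card ι - 1 := by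
    obtain ⟨y, hy, hpy⟩ := hadj i p hp
    have h : (G i).neighborSet p \ W i ⊆ (G i).neighborSet p \ {y} := by
      rintro z ⟨hz, hz'⟩
      exact ⟨hz, fun h => hz' (h ▸ hy)⟩
    have h2 := Set.ncard_le_ncard h (Set.toFinite _)
    rw [Set.ncard_sdiff_singleton_of_mem (show y ∈ (G i).neighborSet p from hpy)] at h2
    have := hdeg i p
    omega
  have hmem : ∀ (T : Set (V i)) (z : ∀ i, V i), z ∈ Set.univ.pi (Function.update Y i T) ↔
      z i ∈ T ∧ ∀ j, j ≠ i → z j ∈ Y j := by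
    intro T z
    constructor
    · intro h
      refine ⟨by simpa using h i trivial, fun j hj => by simpa [hj] using h j trivial⟩
    · intro h j _
      by_cases hj : j = i
      · subst hj
        simpa using h.1
      · simpa [hj] using h.2 j hj
  have hle : {v' | v' ∈ boxBoundary G W i ∧ ∀ a ∈ Set.univ.pi W,
      (strongProduct G).Adj v' a ↔ (strongProduct G).Adj v a}.ncard ≤
      (Fintype.card ι - 1) * N := by
    refine le_trans ?_ (Nat.mul_le_mul_right N hT)
    rw [← ncard_pi_update Y i]
    refine Set.ncard_le_ncard ?_ (Set.toFinite _)
    rintro v' ⟨hv', hsame⟩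
    rw [hmem]
    obtain ⟨h1, h2, h3⟩ := mem_box_of_same_neighbors hW hvj hvi hp hpv
      (fun h => hv'.1 (h i trivial)) hsame
    exact ⟨⟨h2, h1⟩, h3⟩
  have hge : N - 1 ≤ {a | a ∈ Set.univ.pi W ∧ a ∉ ({q₁, q₂} : Set (∀ i, V i)) ∧
      (strongProduct G).Adj v a}.ncard := by
    have hbox := ncard_pi_update Y i {p}
    rw [Set.ncard_singleton, one_mul] at hbox
    have hsub : Set.univ.pi (Function.update Y i {p}) \ {q₁, q₂} ⊆
        {a | a ∈ Set.univ.pi W ∧ a ∉ ({q₁, q₂} : Set (∀ i, V i)) ∧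
          (strongProduct G).Adj v a} := by
      rintro a ⟨ha, haq⟩
      rw [hmem] at ha
      have haW : a ∈ Set.univ.pi W := by
        intro j _
        by_cases hj : j = i
        · subst hj
          rw [show a j = p from ha.1]
          exact hp
        · exact (ha.2 j hj).1
      refine ⟨haW, haq, fun h => hvi (h ▸ haW i trivial), fun j => ?_⟩
      by_cases hj : j = i
      · subst hj
        rw [show a j = p from ha.1]
        exact Or.inr hpv.symm
      · exact (ha.2 j hj).2
    refine le_trans ?_ (Set.ncard_le_ncard hsub (Set.toFinite _))
    -- Since `q₁` and `q₂` differ at `i`, at most one has `p` there, so only one neighbour is lost.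
    obtain ⟨q, hq'⟩ : ∃ q, Set.univ.pi (Function.update Y i {p}) \ {q} ⊆
        Set.univ.pi (Function.update Y i {p}) \ {q₁, q₂} := by
      by_cases h1 : q₁ i = p
      · refine ⟨q₁, ?_⟩
        rintro a ⟨ha, haq⟩
        refine ⟨ha, ?_⟩
        rintro (h | rfl)
        · exact haq h
        · exact hq (h1.trans ((hmem _ _).1 ha).1.symm)
      · refine ⟨q₂, ?_⟩
        rintro a ⟨ha, haq⟩
        refine ⟨ha, ?_⟩
        rintro (rfl | h)
        · exact h1 ((hmem _ _).1 ha).1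
        · exact haq h
    refine le_trans ?_ (Set.ncard_le_ncard hq' (Set.toFinite _))
    have := Set.pred_ncard_le_ncard_sdiff_singleton
      (Set.univ.pi (Function.update Y i {p})) q
    rw [hbox] at this
    exact this
  exact hle.trans ((mul_le_two_pow_pred (by omega) hN).trans
    (Nat.pow_le_pow_right (by norm_num) hge))

/-- At least two coordinates differ from `i`; a move along an edge inside `W j` in either of them
stays in the boundary. -/
theorem exists_two_mem_boxBoundary [Fintype ι] [DecidableEq ι] (hι : 3 ≤ Fintype.card ι)
    {W : ∀ i, Set (V i)} {i : ι} (hadj : ∀ j, ∀ x ∈ W j, ∃ y ∈ W j, (G j).Adj x y)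
    {v : ∀ i, V i} (hv : v ∈ boxBoundary G W i) :
    ∃ y ∈ boxBoundary G W i, ∃ z ∈ boxBoundary G W i, y ≠ z ∧
      (strongProduct G).Adj v y ∧ (strongProduct G).Adj v z := by
  have key : ∀ j, j ≠ i → ∃ x, x ≠ v j ∧ Function.update v j x ∈ boxBoundary G W i ∧
      (strongProduct G).Adj v (Function.update v j x) := by
    intro j hj
    obtain ⟨x, hx, hvx⟩ := hadj j (v j) (hv.2.2 j hj)
    refine ⟨x, hvx.ne.symm, ⟨?_, ?_, fun l hl => ?_⟩, fun h => ?_, fun l => ?_⟩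
    · simpa [hj.symm] using hv.1
    · simpa [hj.symm] using hv.2.1
    · by_cases hlj : l = j
      · subst hlj
        simpa using hx
      · simpa [hlj] using hv.2.2 l hl
    · have := congrFun h j
      simp only [Function.update_self] at this
      exact hvx.ne this
    · by_cases hlj : l = j
      · subst hlj
        simpa using Or.inr hvx
      · simp [hlj]
  obtain ⟨j, hj⟩ : ∃ j, j ≠ i := by
    have : Nontrivial ι := Fintype.one_lt_card_iff_nontrivial.1 (by omega)
    exact exists_ne i
  obtain ⟨l, hl⟩ : ∃ l, l ∉ ({i, j} : Finset ι) := by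
    by_contra! h
    have h1 := Finset.card_le_card (fun l _ => h l : Finset.univ ⊆ ({i, j} : Finset ι))
    have h2 := Finset.card_le_two (a := i) (b := j)
    rw [Finset.card_univ] at h1
    omega
  simp only [Finset.mem_insert, Finset.mem_singleton, not_or] at hl
  obtain ⟨x, hxne, hx1, hx2⟩ := key j hj
  obtain ⟨y, hyne, hy1, hy2⟩ := key l hl.1
  refine ⟨_, hx1, _, hy1, fun h => hxne ?_, hx2, hy2⟩
  have := congrFun h j
  simpa [Ne.symm hl.2] using this

theorem pi_union_boxBoundary [DecidableEq ι] (W : ∀ i, Set (V i)) (i : ι) :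
    Set.univ.pi W ∪ boxBoundary G W i =
      Set.univ.pi (Function.update W i {x | x ∈ W i ∨ ∃ p ∈ W i, (G i).Adj p x}) := by
  ext v
  constructor
  · rintro (h | h) j -
    · by_cases hj : j = i
      · subst hj
        simpa using Or.inl (h j trivial)
      · simpa [hj] using h j trivial
    · by_cases hj : j = i
      · subst hj
        simpa using Or.inr h.2.1
      · simpa [hj] using h.2.2 j hj
  · intro h
    have h1 : ∀ j, j ≠ i → v j ∈ W j := fun j hj => by simpa [hj] using h j trivial
    have h2 : v i ∈ W i ∨ ∃ p ∈ W i, (G i).Adj p (v i) := by simpa using h i trivial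
    by_cases hi : v i ∈ W i
    · refine Or.inl fun j _ => ?_
      by_cases hj : j = i
      · subst hj
        exact hi
      · exact h1 j hj
    · exact Or.inr ⟨hi, h2.resolve_left hi, h1⟩

end Step

/-! ### Filling the box, and the case of at least three factors -/

section Box

variable {ι : Type*} {V : ι → Type*} {G : ∀ i, SimpleGraph (V i)}

theorem Propagates.extend_box [Fintype ι] [DecidableEq ι] [∀ i, Finite (V i)]
    (hι : 3 ≤ Fintype.card ι)
    (hdeg : ∀ i v, ((G i).neighborSet v).ncard ≤ Fintype.card ι) {W : ∀ i, Set (V i)} {i : ι}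
    (hW : ∀ j, j ≠ i → (G j).IsTwinClosed (W j)) (hadj : ∀ j, ∀ x ∈ W j, ∃ y ∈ W j, (G j).Adj x y)
    {q₁ q₂ : ∀ i, V i} (hq : q₁ i ≠ q₂ i) {Q : Set (∀ i, V i)} (h₁ : q₁ ∈ Q) (h₂ : q₂ ∈ Q)
    (hQ : Q ⊆ Set.univ.pi W) {S₀ S : SimpleGraph (∀ i, V i)}
    (hS : Propagates (strongProduct G) S₀ q₁ {q₁, q₂} Q (Set.univ.pi W) S) :
    ∃ S', Propagates (strongProduct G) S₀ q₁ {q₁, q₂} Q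
      (Set.univ.pi (Function.update W i {x | x ∈ W i ∨ ∃ p ∈ W i, (G i).Adj p x})) S' := by
  rw [← pi_union_boxBoundary]
  refine hS.extend ?_ hQ ?_ ?_ ?_ ?_
  · rintro x (rfl | rfl)
    · exact hQ h₁
    · exact hQ h₂
  · exact Set.disjoint_left.2 fun v hv hv' => hv'.1 (hv i trivial)
  · rintro v ⟨hvi, ⟨p, hp, hpv⟩, hvj⟩ v' hv' hsame
    obtain ⟨h1, h2, h3⟩ := mem_box_of_same_neighbors hW hvj hvi hp hpv hv' hsame
    exact ⟨h1, ⟨p, hp, h2⟩, fun j hj => (h3 j hj).1⟩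
  · exact fun v hv => ncard_boxBoundary_class_le hι hdeg hW hadj hq hv
  · exact fun v hv => exists_two_mem_boxBoundary hι hadj hv

/-- A maximal admissible `X ⊇ W i` absorbs its neighbours by `Propagates.extend_box`, so
connectedness makes it everything. -/
theorem Propagates.extend_univ [Fintype ι] [DecidableEq ι] [∀ i, Finite (V i)]
    (hι : 3 ≤ Fintype.card ι) (hconn : ∀ i, (G i).Connected)
    (hdeg : ∀ i v, ((G i).neighborSet v).ncard ≤ Fintype.card ι) {W : ∀ i, Set (V i)} {i : ι}
    (hW : ∀ j, j ≠ i → (G j).IsTwinClosed (W j)) (hadj : ∀ j, ∀ x ∈ W j, ∃ y ∈ W j, (G j).Adj x y)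
    {q₁ q₂ : ∀ i, V i} (hq : q₁ i ≠ q₂ i) {Q : Set (∀ i, V i)} (h₁ : q₁ ∈ Q) (h₂ : q₂ ∈ Q)
    (hQ : Q ⊆ Set.univ.pi W) {S₀ S : SimpleGraph (∀ i, V i)}
    (hS : Propagates (strongProduct G) S₀ q₁ {q₁, q₂} Q (Set.univ.pi W) S) :
    ∃ S', Propagates (strongProduct G) S₀ q₁ {q₁, q₂} Q
      (Set.univ.pi (Function.update W i Set.univ)) S' := by
  obtain ⟨X, hWX, hX⟩ := Finite.exists_le_maximal (a := W i) (p := fun X : Set (V i) =>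
    W i ⊆ X ∧ (∀ x ∈ X, ∃ y ∈ X, (G i).Adj x y) ∧
      ∃ S', Propagates (strongProduct G) S₀ q₁ {q₁, q₂} Q
        (Set.univ.pi (Function.update W i X)) S')
    ⟨le_rfl, hadj i, S, by rwa [Function.update_eq_self]⟩
  obtain ⟨-, hXadj, S', hS'⟩ := hX.prop
  suffices h : X = Set.univ from h ▸ ⟨S', hS'⟩
  have hstep := hS'.extend_box (i := i) hι hdeg (fun j hj => by simpa [hj] using hW j hj)
    (fun j => by
      by_cases hj : j = i
      · subst hj
        simpa using hXadj
      · simpa [hj] using hadj j) hq h₁ h₂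
    (hQ.trans fun v hv j _ => by
      by_cases hj : j = i
      · subst hj
        simpa using hWX (hv j trivial)
      · simpa [hj] using hv j trivial)
  simp only [Function.update_self, Function.update_idem] at hstep
  have hmax : {x | x ∈ X ∨ ∃ p ∈ X, (G i).Adj p x} ⊆ X := by
    refine hX.le_of_ge ⟨fun x hx => Or.inl (hWX hx), ?_, hstep⟩ fun x hx => Or.inl hx
    rintro x (hx | ⟨p, hp, hpx⟩)
    · obtain ⟨y, hy, hxy⟩ := hXadj x hx
      exact ⟨y, Or.inl hy, hxy⟩
    · exact ⟨p, Or.inl hp, hpx.symm⟩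
  by_contra hne
  obtain ⟨w, hw⟩ := (Set.ne_univ_iff_exists_notMem X).1 hne
  obtain ⟨P⟩ := (hconn i).preconnected (q₁ i) w
  obtain ⟨d, -, hd1, hd2⟩ := P.exists_boundary_dart X (hWX (hQ h₁ i trivial)) hw
  exact hd2 (hmax (Or.inr ⟨_, hd1, d.adj⟩))

theorem two_pow_card_le_ncard_pi [Fintype ι] [∀ i, Finite (V i)] {C : ∀ i, Set (V i)}
    (hC : ∀ i, 2 ≤ (C i).ncard) : 2 ^ Fintype.card ι ≤ (Set.univ.pi C).ncard := by
  classical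
  have := fun i => Fintype.ofFinite (V i)
  have h : Set.univ.pi C = ↑(Fintype.piFinset fun j => (C j).toFinset) := by
    ext x
    simp
  rw [h, Set.ncard_coe_finset, Fintype.card_piFinset, ← Finset.card_univ]
  refine Finset.pow_card_le_prod _ _ _ fun j _ => ?_
  rw [← Set.ncard_eq_toFinset_card']
  exact hC j

theorem strongProduct_distinguishingIndex_le_two [Fintype ι] [∀ i, Finite (V i)]
    [∀ i, Nontrivial (V i)] (hι : 3 ≤ Fintype.card ι) (hconn : ∀ i, (G i).Connected)
    (hdeg : ∀ i v, ((G i).neighborSet v).ncard ≤ Fintype.card ι) :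
    (strongProduct G).distinguishingIndex ≤ 2 := by
  classical
  have hedge : ∀ i, ∃ u w, (G i).Adj u w := fun i => by
    obtain ⟨w, hw⟩ := (hconn i).preconnected.exists_adj_of_nontrivial (Classical.arbitrary (V i))
    exact ⟨_, w, hw⟩
  choose q₁ q₂ hq using hedge
  choose C h₁ h₂ hclique htwin using fun i => exists_isTwinClosed_isClique (hq i)
  have hCadj : ∀ j, ∀ x ∈ C j, ∃ y ∈ C j, (G j).Adj x y := by
    intro j x hx
    by_cases h : x = q₁ j
    · exact ⟨q₂ j, h₂ j, h ▸ hq j⟩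
    · exact ⟨q₁ j, h₁ j, hclique j hx (h₁ j) h⟩
  have hQclique : (strongProduct G).IsClique (Set.univ.pi C) := by
    intro x hx y hy hxy
    refine ⟨hxy, fun j => ?_⟩
    by_cases h : x j = y j
    · exact Or.inl h
    · exact Or.inr (hclique j (hx j trivial) (hy j trivial) h)
  have hcard : 8 ≤ (Set.univ.pi C).ncard := by
    refine le_trans ?_ (two_pow_card_le_ncard_pi fun i => ?_)
    · exact le_trans (by norm_num : 8 ≤ 2 ^ 3) (Nat.pow_le_pow_right (by norm_num) hι)
    · rw [← Set.ncard_pair (hq i).ne]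
      exact Set.ncard_le_ncard (Set.insert_subset (h₁ i) (Set.singleton_subset_iff.2 (h₂ i)))
        (Set.toFinite _)
  have hne : q₁ ≠ q₂ := by
    have : Nonempty ι := Fintype.card_pos_iff.1 (by omega)
    exact fun h => (hq (Classical.arbitrary ι)).ne (congrFun h _)
  have hq₁ : q₁ ∈ Set.univ.pi C := fun i _ => h₁ i
  have hq₂ : q₂ ∈ Set.univ.pi C := fun i _ => h₂ i
  obtain ⟨S₀, hS₀⟩ := exists_isRigidBase hq₁ hq₂ hne hcard
  -- `J` is the set of coordinates already filled; both filled sides and the initial cliques are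
  -- twin-closed.
  have key : ∀ J : Finset ι, ∃ S, Propagates (strongProduct G) S₀ q₁ {q₁, q₂} (Set.univ.pi C)
      (Set.univ.pi fun j => if j ∈ J then Set.univ else C j) S := by
    intro J
    induction J using Finset.induction_on with
    | empty => exact ⟨S₀, by simpa using Propagates.of_isRigidBase hS₀ hQclique (by omega)⟩
    | insert i J hiJ ih =>
      obtain ⟨S, hS⟩ := ih
      obtain ⟨S', hS'⟩ := hS.extend_univ (i := i) hι hconn hdeg
        (fun j _ => by
          split_ifs
          · exact isTwinClosed_univ _
          · exact htwin j)
        (fun j x hx => by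
          split_ifs at hx ⊢
          · obtain ⟨y, hy⟩ := (hconn j).preconnected.exists_adj_of_nontrivial x
            exact ⟨y, trivial, hy⟩
          · exact hCadj j x hx)
        (hq i).ne hq₁ hq₂
        (fun v hv j _ => by
          split_ifs
          · trivial
          · exact hv j trivial)
      refine ⟨S', ?_⟩
      convert hS' using 2
      ext j : 1
      by_cases hj : j = i
      · subst hj
        simp
      · simp [hj]
  obtain ⟨S, hS⟩ := key Finset.univ
  refine Propagates.distinguishingIndex_le_two hS₀ (S := S) ?_
  simpa using hS

end Box

/-! ### Two factors: Hamiltonian paths and the snake -/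

/-- By connectedness some edge leaves a path that is not spanning. It starts at an end, as an inner
vertex has both neighbours on the path, and so it lengthens the path. -/
theorem exists_hamiltonian_path_of_ncard_neighborSet_le_two {V : Type*} [Fintype V]
    {G : SimpleGraph V} (hconn : G.Connected) (hdeg : ∀ v, (G.neighborSet v).ncard ≤ 2) :
    ∃ f : ℕ → V, Set.InjOn f (Set.Iio (Fintype.card V)) ∧
      ∀ t, t + 1 < Fintype.card V → G.Adj (f t) (f (t + 1)) := by
  classical
  have key : ∀ n, 1 ≤ n → n ≤ Fintype.card V → ∃ f : ℕ → V, Set.InjOn f (Set.Iio n) ∧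
      ∀ t, t + 1 < n → G.Adj (f t) (f (t + 1)) := by
    intro n hn
    induction n, hn using Nat.le_induction with
    | base =>
      have := hconn.nonempty
      refine fun _ => ⟨fun _ => Classical.arbitrary V, fun s hs t ht _ => ?_, fun t ht => ?_⟩
      · simp only [Set.mem_Iio] at hs ht
        omega
      · omega
    | succ n hn ih =>
      intro hnV
      obtain ⟨f, hinj, hadj⟩ := ih (by omega)
      obtain ⟨w, hw⟩ : ∃ w, w ∉ (Finset.range n).image f := by
        by_contra! h
        have h1 := Finset.card_le_card (fun x _ => h x : Finset.univ ⊆ (Finset.range n).image f)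
        have h2 := Finset.card_image_le (s := Finset.range n) (f := f)
        rw [Finset.card_univ] at h1
        rw [Finset.card_range] at h2
        omega
      obtain ⟨P⟩ := hconn.preconnected (f 0) w
      obtain ⟨d, -, hd1, hd2⟩ := P.exists_boundary_dart ((Finset.range n).image f : Finset V)
        (Finset.mem_coe.2 (Finset.mem_image_of_mem f (Finset.mem_range.2 (by omega))))
        (by exact_mod_cast hw)
      rw [Finset.mem_coe, Finset.mem_image] at hd1
      obtain ⟨t, ht, htd⟩ := hd1
      rw [Finset.mem_range] at ht
      have hty : G.Adj (f t) d.snd := htd ▸ d.adj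
      generalize d.snd = y at hty hd2
      have hy : ∀ s, s < n → f s ≠ y := fun s hs h => hd2 (Finset.mem_coe.2
        (h ▸ Finset.mem_image_of_mem f (Finset.mem_range.2 hs)))
      by_cases hlast : t + 1 = n
      · refine ⟨fun s => if s < n then f s else y, ?_, fun s hs => ?_⟩
        · intro s hs r hr hsr
          simp only [Set.mem_Iio] at hs hr
          simp only at hsr
          split_ifs at hsr with h1 h2 h2
          · exact hinj h1 h2 hsr
          · exact absurd hsr (hy s h1)
          · exact absurd hsr.symm (hy r h2)
          · omega
        · by_cases h1 : s + 1 < n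
          · simpa [h1, show s < n by omega] using hadj s h1
          · obtain rfl : s = t := by omega
            simpa [h1, ht] using hty
      by_cases hfirst : t = 0
      · subst hfirst
        refine ⟨fun s => if s = 0 then y else f (s - 1), ?_, fun s hs => ?_⟩
        · intro s hs r hr hsr
          simp only [Set.mem_Iio] at hs hr
          simp only at hsr
          split_ifs at hsr with h1 h2 h2
          · omega
          · exact absurd hsr.symm (hy (r - 1) (by omega))
          · exact absurd hsr (hy (s - 1) (by omega))
          · have := hinj (show s - 1 < n by omega) (show r - 1 < n by omega) hsr
            omega
        · by_cases h1 : s = 0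
          · subst h1
            simpa using hty.symm
          · have h2 := hadj (s - 1) (by omega)
            rw [show s - 1 + 1 = s by omega] at h2
            simpa [h1] using h2
      exfalso
      have h1 := hadj t (by omega)
      have h2 := hadj (t - 1) (by omega)
      rw [show t - 1 + 1 = t by omega] at h2
      have h3 : f (t - 1) ≠ f (t + 1) := by
        intro h
        have := hinj (show t - 1 < n by omega) (show t + 1 < n by omega) h
        omega
      have h4 : ({f (t - 1), f (t + 1), y} : Set V).ncard = 3 :=
        Set.ncard_eq_three.2 ⟨_, _, _, h3, hy _ (by omega), hy _ (by omega), rfl⟩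
      have h5 : ({f (t - 1), f (t + 1), y} : Set V) ⊆ G.neighborSet (f t) := by
        rintro z (rfl | rfl | rfl)
        · exact h2.symm
        · exact h1
        · exact hty
      have h6 := Set.ncard_le_ncard h5 (Set.toFinite _)
      have := hdeg (f t)
      omega
  exact key _ (Fintype.card_pos_iff.2 hconn.nonempty) le_rfl

/-- The boustrophedon enumeration of a grid with rows of length `n`: the column at time `t`. -/
def snakeColumn (n t : ℕ) : ℕ := if t / n % 2 = 0 then t % n else n - 1 - t % n

theorem snakeColumn_lt {n : ℕ} (hn : 0 < n) (t : ℕ) : snakeColumn n t < n := by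
  have := Nat.mod_lt t hn
  unfold snakeColumn
  split_ifs <;> omega

theorem snake_injective {n s t : ℕ} (hn : 0 < n) (h : s / n = t / n)
    (h' : snakeColumn n s = snakeColumn n t) : s = t := by
  have h1 := Nat.mod_lt s hn
  have h2 := Nat.mod_lt t hn
  have h3 : s % n = t % n := by
    unfold snakeColumn at h'
    rw [h] at h'
    split_ifs at h' <;> omega
  rw [← Nat.div_add_mod s n, ← Nat.div_add_mod t n, h, h3]

theorem snake_step {n : ℕ} (hn : 0 < n) (t : ℕ) :
    (t / n = (t + 1) / n ∧ (snakeColumn n t + 1 = snakeColumn n (t + 1) ∨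
      snakeColumn n (t + 1) + 1 = snakeColumn n t)) ∨
    (t / n + 1 = (t + 1) / n ∧ snakeColumn n t = snakeColumn n (t + 1)) := by
  have h1 := Nat.mod_lt t hn
  by_cases h : t % n + 1 = n
  · right
    have h2 : t + 1 = n * (t / n + 1) + 0 := by
      rw [mul_add, mul_one, add_zero]
      conv_lhs => rw [← Nat.div_add_mod t n]
      omega
    have h3 : (t + 1) / n = t / n + 1 := by
      rw [h2, Nat.mul_add_div hn, Nat.zero_div, add_zero]
    have h4 : (t + 1) % n = 0 := by
      rw [h2, Nat.mul_add_mod, Nat.zero_mod]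
    refine ⟨h3.symm, ?_⟩
    unfold snakeColumn
    rw [h3, h4]
    split_ifs <;> omega
  · left
    have h2 : t + 1 = n * (t / n) + (t % n + 1) := by
      conv_lhs => rw [← Nat.div_add_mod t n]
      omega
    have h3 : (t + 1) / n = t / n := by
      have h5 : t % n + 1 < n := by omega
      rw [h2, Nat.mul_add_div hn, Nat.div_eq_of_lt h5, add_zero]
    have h4 : (t + 1) % n = t % n + 1 := by
      rw [h2, Nat.mul_add_mod, Nat.mod_eq_of_lt (by omega)]
    refine ⟨h3.symm, ?_⟩
    unfold snakeColumn
    rw [h3, h4]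
    split_ifs <;> omega

theorem distinguishingIndex_le_two_of_grid {A B X : Type*} [Fintype A] [Fintype B]
    {GA : SimpleGraph A} {GB : SimpleGraph B} {H : SimpleGraph X} (φ : A × B ≃ X)
    (hφ : ∀ p q : A × B, p ≠ q → (p.1 = q.1 ∨ GA.Adj p.1 q.1) → (p.2 = q.2 ∨ GB.Adj p.2 q.2) →
      H.Adj (φ p) (φ q))
    (hA : GA.Connected) (hB : GB.Connected) (hdA : ∀ v, (GA.neighborSet v).ncard ≤ 2)
    (hdB : ∀ v, (GB.neighborSet v).ncard ≤ 2) (hcA : 2 ≤ Fintype.card A)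
    (hcB : 3 ≤ Fintype.card B) : H.distinguishingIndex ≤ 2 := by
  obtain ⟨f, hfi, hfa⟩ := exists_hamiltonian_path_of_ncard_neighborSet_le_two hA hdA
  obtain ⟨g, hgi, hga⟩ := exists_hamiltonian_path_of_ncard_neighborSet_le_two hB hdB
  set m := Fintype.card A with hm
  set n := Fintype.card B with hn
  have hn0 : 0 < n := by omega
  have hdiv : ∀ t, t < m * n → t / n < m := fun t ht => Nat.div_lt_of_lt_mul (by rwa [mul_comm])
  let c : Fin (m * n) → A × B := fun t => (f (t.1 / n), g (snakeColumn n t.1))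
  have hinj : Function.Injective c := by
    intro s t h
    have h1 := hfi (hdiv s s.2) (hdiv t t.2) (congrArg Prod.fst h)
    have h2 := hgi (snakeColumn_lt hn0 _) (snakeColumn_lt hn0 _) (congrArg Prod.snd h)
    exact Fin.ext (snake_injective hn0 h1 h2)
  have hbij : Function.Bijective c := by
    rw [Fintype.bijective_iff_injective_and_card]
    exact ⟨hinj, by rw [Fintype.card_fin, Fintype.card_prod]⟩
  -- With the chord at `n - 2`, the rigidity bound is `2 * n ≤ m * n`: two rows suffice.
  have h2n : 2 * (n - 2) + 4 ≤ m * n := by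
    have := Nat.mul_le_mul_right n hcA
    omega
  have hstep : ∀ s t : Fin (m * n), s.1 + 1 = t.1 → H.Adj (φ (c s)) (φ (c t)) := by
    intro s t h
    have hst : c s ≠ c t := fun h' => by
      rw [hinj h'] at h
      omega
    have ht : s.1 + 1 < m * n := h ▸ t.2
    have hcol := snakeColumn_lt hn0 s.1
    have hcol' := snakeColumn_lt hn0 (s.1 + 1)
    have hrow := hdiv _ ht
    refine hφ _ _ hst ?_ ?_
    · simp only [c, ← h]
      rcases snake_step hn0 s.1 with ⟨h1, -⟩ | ⟨h1, -⟩
      · exact Or.inl (congrArg f h1)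
      · rw [← h1] at hrow ⊢
        exact Or.inr (hfa _ hrow)
    · simp only [c, ← h]
      rcases snake_step hn0 s.1 with ⟨-, h1 | h1⟩ | ⟨-, h1⟩
      · rw [← h1] at hcol' ⊢
        exact Or.inr (hga _ hcol')
      · rw [← h1] at hcol ⊢
        exact Or.inr (hga _ hcol).symm
      · exact Or.inl (congrArg g h1)
  -- Time `n - 2` is in row `0`, column `n - 2`; time `n` is in row `1`, column `n - 1`. The chord
  -- is a diagonal of the grid.
  have hchord : ∀ s t : Fin (m * n), s.1 = n - 2 → t.1 = n - 2 + 2 →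
      H.Adj (φ (c s)) (φ (c t)) := by
    intro s t hs ht
    have ht' : t.1 = n := by omega
    have hst : c s ≠ c t := fun h' => by
      rw [hinj h'] at hs
      omega
    have hs1 : s.1 / n = 0 := Nat.div_eq_of_lt (by omega)
    have hs2 : snakeColumn n s.1 = n - 2 := by
      rw [snakeColumn, hs1, Nat.mod_eq_of_lt (by omega), hs]
      simp
    have ht1 : t.1 / n = 1 := by rw [ht', Nat.div_self hn0]
    have ht2 : snakeColumn n t.1 = n - 2 + 1 := by
      rw [snakeColumn, ht1, ht', Nat.mod_self]
      simp only [Nat.one_mod, one_ne_zero, if_false]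
      omega
    refine hφ _ _ hst ?_ ?_
    · simp only [c, hs1, ht1]
      exact Or.inr (hfa 0 (by omega))
    · simp only [c, hs2, ht2]
      exact Or.inr (hga _ (by omega))
  refine distinguishingIndex_le_two_of_pathWithChord (i := n - 2) (by omega) h2n
    ((Equiv.ofBijective c hbij).trans φ) ?_
  rintro s t (h | h | ⟨h, h'⟩ | ⟨h, h'⟩)
  · exact hstep s t h
  · exact (hstep t s h).symm
  · exact hchord s t h h'
  · exact (hchord t s h h').symm

theorem strongProduct_fin_two_distinguishingIndex_le_two {V : Fin 2 → Type*} [∀ i, Fintype (V i)]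
    [∀ i, Nontrivial (V i)] {G : ∀ i, SimpleGraph (V i)} (hconn : ∀ i, (G i).Connected)
    (hdeg : ∀ i v, ((G i).neighborSet v).ncard ≤ 2) (hcard : 7 ≤ ∏ i, Fintype.card (V i)) :
    (strongProduct G).distinguishingIndex ≤ 2 := by
  have h0 := Fintype.one_lt_card (α := V 0)
  have h1 := Fintype.one_lt_card (α := V 1)
  rw [Fin.prod_univ_two] at hcard
  by_cases h : 3 ≤ Fintype.card (V 1)
  · refine distinguishingIndex_le_two_of_grid (piFinTwoEquiv V).symm ?_ (hconn 0) (hconn 1)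
      (hdeg 0) (hdeg 1) h0 h
    intro p q hne hp hq
    exact ⟨fun h' => hne ((piFinTwoEquiv V).symm.injective h'), Fin.forall_fin_two.2 ⟨hp, hq⟩⟩
  · have h3 : 3 ≤ Fintype.card (V 0) := by nlinarith
    refine distinguishingIndex_le_two_of_grid
      ((Equiv.prodComm _ _).trans (piFinTwoEquiv V).symm) ?_ (hconn 1) (hconn 0)
      (hdeg 1) (hdeg 0) h1 h3
    intro p q hne hp hq
    exact ⟨fun h' => hne (Equiv.injective _ h'), Fin.forall_fin_two.2 ⟨hq, hp⟩⟩

end SimpleGraph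

theorem mainTheorem3 (Δ : ℕ) (hΔ : 2 ≤ Δ) (V : Fin Δ → Type*) [∀ i, Fintype (V i)]
    [∀ i, Nontrivial (V i)] (G : ∀ i, SimpleGraph (V i)) [∀ i, DecidableRel (G i).Adj]
    (hconn : ∀ i, (G i).Connected) (hdeg : ∀ i, (G i).maxDegree ≤ Δ)
    (hcard : 7 ≤ ∏ i, Fintype.card (V i)) :
    (SimpleGraph.strongProduct G).distinguishingIndex ≤ 2 := by
  have hdeg' : ∀ i v, ((G i).neighborSet v).ncard ≤ Δ := by
    intro i v
    rw [Set.ncard_eq_toFinset_card']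
    exact ((G i).degree_le_maxDegree v).trans (hdeg i)
  rcases hΔ.eq_or_lt with rfl | h
  · exact SimpleGraph.strongProduct_fin_two_distinguishingIndex_le_two hconn hdeg' hcard
  · exact SimpleGraph.strongProduct_distinguishingIndex_le_two (by rw [Fintype.card_fin]; omega)
      hconn (by simpa using hdeg')
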